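/- Let $n\ge 1$ and $[n]=\{1,\dots,n\}$. Identify a subset $B\subseteq[n]$ with the lattice path of $n$ unit steps whose $i$-th step is north if $i\in B$ and east otherwise. For $U,L\subseteq[n]$ with $|U|=|L|$ such that the path $U$ never goes below the path $L$, the lattice path matroid (LPM) $M[U,L]$ is the matroid on $[n]$ whose bases are the sets $B$ whose path has the same endpoints as $U$ and $L$ and stays weakly between them; $M[U,L]$ determines $(U,L)$. A matroid $M'$ is a quotient of a matroid $M$ on the same ground set if there are a matroid $N$ and a finite subset $T$ of its ground set with $M=N\setminus T$ and $M'=N/T$. Let $\mathcal P_n$ be the set of all LPMs on $[n]$, partially ordered by $M'\le_q M$ if $M'$ is a quotient of $M$. If $M=M[U,L]$ covers $M'=M[U',L']$ in $\mathcal P_n$, then $L\setminus L'=\{\ell\}$ and $U\setminus U'=\{u\}$ for some $\ell,u\in[n]$, and this cover is labeled by $\lambda(M'\lessdot M)=(\ell,u)\in[n]\times[n]$; labels are compared in the product order, $(\ell,u)\le(\ell',u')$ if $\ell\le\ell'$ and $u\le u'$. A falling chain of an interval $[x,y]$ of $\mathcal P_n$ is a maximal chain $x=x_0\lessdot x_1\lessdot\cdots\lessdot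 x_m=y$ of it such that $\lambda(x_{i-1}\lessdot x_i)\not<\lambda(x_i\lessdot x_{i+1})$ for all $0<i<m$. For $k\in[n]$ let $M_{k,1}=M[[n]\setminus\{k\},[n]\setminus\{1\}]$, let $U_{0,n}=M[\emptyset,\emptyset]$ be the rank $0$ uniform matroid on $[n]$, and let $FC_k$ be the set of falling chains of the interval $[U_{0,n},M_{k,1}]$ of $\mathcal P_n$. **Theorem.** For all $a,b\in[n]$ with $a\ge b$, we have $|FC_a|\ge|FC_b|$. -/

import Mathlib

namespace LPMPoset

/-- The number of elements of `B` among the first `i` elements of the ground set `Fin n`, that is,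
the height after `i` steps of the lattice path whose north steps are the elements of `B`. -/
def height {n : ℕ} (B : Finset (Fin n)) (i : ℕ) : ℕ := (B.filter (fun x => x.val < i)).card

theorem height_zero {n : ℕ} (B : Finset (Fin n)) : height B 0 = 0 := by
  simp [height]

theorem height_top {n : ℕ} (B : Finset (Fin n)) : height B n = B.card := by
  simp [height]

theorem height_succ {n : ℕ} (B : Finset (Fin n)) (x : Fin n) :
    height B (x.val + 1) = height B x.val + if x ∈ B then 1 else 0 := by
  unfold height
  split_ifs with h
  · rw [← Finset.card_insert_of_notMem (a := x) (by simp)]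
    congr 1
    ext y
    simp only [Finset.mem_filter, Finset.mem_insert]
    constructor
    · rintro ⟨hy, hlt⟩
      rcases Nat.lt_succ_iff_lt_or_eq.mp hlt with h1 | h1
      · exact Or.inr ⟨hy, h1⟩
      · exact Or.inl (Fin.ext h1)
    · rintro (rfl | ⟨hy, hlt⟩)
      · exact ⟨h, Nat.lt_succ_self _⟩
      · exact ⟨hy, Nat.lt_succ_of_lt hlt⟩
  · rw [Nat.add_zero]
    congr 1
    ext y
    simp only [Finset.mem_filter]
    constructor
    · rintro ⟨hy, hlt⟩
      rcases Nat.lt_succ_iff_lt_or_eq.mp hlt with h1 | h1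
      · exact ⟨hy, h1⟩
      · exact absurd (Fin.ext h1 ▸ hy) h
    · rintro ⟨hy, hlt⟩
      exact ⟨hy, Nat.lt_succ_of_lt hlt⟩

theorem eq_of_height_eq {n : ℕ} {A B : Finset (Fin n)} (h : ∀ i, height A i = height B i) :
    A = B := by
  ext x
  have h1 := height_succ A x
  have h2 := height_succ B x
  rw [h, h x.val, h2] at h1
  by_cases hA : x ∈ A <;> by_cases hB : x ∈ B <;> simp_all

/-- The data `(U, L)` of a lattice path matroid on the ground set `[n]` (modelled by `Fin n`, whose
element `i` stands for `i + 1`): two monotone lattice paths with the same endpoints, given by their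
sets of north steps, such that the path `U` is never below the path `L`. -/
@[ext]
structure LPM (n : ℕ) where
  /-- the north steps of the upper path -/
  U : Finset (Fin n)
  /-- the north steps of the lower path -/
  L : Finset (Fin n)
  card_eq : U.card = L.card
  noncrossing : ∀ i, height L i ≤ height U i

namespace LPM

variable {n : ℕ}

/-- `B` is the set of north steps of a lattice path that has the same endpoints as `U` and `L` and
stays between them. -/
def IsPath (M : LPM n) (B : Finset (Fin n)) : Prop :=
  B.card = M.U.card ∧ ∀ i, height M.L i ≤ height B i ∧ height B i ≤ height M.U i

theorem isPath_U (M : LPM n) : M.IsPath M.U := ⟨rfl, fun i => ⟨M.noncrossing i, le_rfl⟩⟩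

theorem isPath_L (M : LPM n) : M.IsPath M.L :=
  ⟨M.card_eq.symm, fun i => ⟨le_rfl, M.noncrossing i⟩⟩

theorem height_exchange {B : Finset (Fin n)} {x y : Fin n} (hx : x ∈ B) (hy : y ∉ B) (i : ℕ) :
    height (insert y (B.erase x)) i + (if x.val < i then 1 else 0)
      = height B i + (if y.val < i then 1 else 0) := by
  have hy' : y ∉ B.erase x := fun h => hy (Finset.mem_of_mem_erase h)
  have e1 : ∀ A : Finset (Fin n), height A i = ∑ z ∈ A, if z.val < i then 1 else 0 := by
    intro A
    exact Finset.card_filter _ _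
  rw [e1, e1, Finset.sum_insert hy', ← Finset.sum_erase_add B _ hx]
  omega

theorem exists_exchange (M : LPM n) {B₁ B₂ : Finset (Fin n)} (h₁ : M.IsPath B₁)
    (h₂ : M.IsPath B₂) {x : Fin n} (hx₁ : x ∈ B₁) (hx₂ : x ∉ B₂) :
    ∃ y, y ∈ B₂ ∧ y ∉ B₁ ∧ M.IsPath (insert y (B₁.erase x)) := by
  have hcard : ∀ y, y ∉ B₁ → (insert y (B₁.erase x)).card = M.U.card := by
    intro y hy
    rw [Finset.card_insert_of_notMem (fun h => hy (Finset.mem_of_mem_erase h)),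
      Finset.card_erase_add_one hx₁, h₁.1]
  have s1 := height_succ B₁ x
  have s2 := height_succ B₂ x
  rw [if_pos hx₁] at s1
  rw [if_neg hx₂] at s2
  have hend : height B₁ n = height B₂ n := by
    rw [height_top, height_top, h₁.1, h₂.1]
  rcases Nat.lt_or_ge (height B₂ (x.val + 1)) (height B₁ (x.val + 1)) with hd | hd
  · -- the first return of the two paths to the same height after `x`
    have hex : ∃ i, x.val + 1 ≤ i ∧ height B₁ i ≤ height B₂ i := ⟨n, x.isLt, hend.le⟩
    classical
    obtain ⟨hxi, hle⟩ := Nat.find_spec hex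
    have hmin : ∀ j, x.val + 1 ≤ j → j < Nat.find hex → height B₂ j < height B₁ j := by
      intro j hj hlt
      have := Nat.find_min hex hlt
      by_contra hc
      exact this ⟨hj, not_lt.mp hc⟩
    have hin : Nat.find hex ≤ n := Nat.find_le ⟨x.isLt, hend.le⟩
    generalize Nat.find hex = i at *
    have hne : i ≠ x.val + 1 := by
      rintro rfl
      omega
    obtain ⟨j, rfl⟩ : ∃ j, i = j + 1 := ⟨i - 1, by omega⟩
    have hj := hmin j (by omega) (by omega)
    have t1 := height_succ B₁ ⟨j, by omega⟩
    have t2 := height_succ B₂ ⟨j, by omega⟩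
    simp only at t1 t2
    have hy₁ : (⟨j, by omega⟩ : Fin n) ∉ B₁ := by
      intro hc
      rw [if_pos hc] at t1
      split_ifs at t2 <;> omega
    have hy₂ : (⟨j, by omega⟩ : Fin n) ∈ B₂ := by
      by_contra hc
      rw [if_neg hc] at t2
      omega
    refine ⟨⟨j, by omega⟩, hy₂, hy₁, hcard _ hy₁, fun k => ?_⟩
    have hk := height_exchange hx₁ hy₁ k
    simp only at hk
    have b1 := h₁.2 k
    have b2 := h₂.2 k
    have b3 := hmin k
    split_ifs at hk <;> omega
  · -- the last time before `x` at which the two paths had the same height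
    have hd' : height B₁ x.val < height B₂ x.val := by omega
    classical
    have hex : ∃ i, i ≤ x.val ∧ height B₂ (x.val - i) ≤ height B₁ (x.val - i) :=
      ⟨x.val, le_rfl, by simp [height_zero]⟩
    obtain ⟨hxi, hle⟩ := Nat.find_spec hex
    have hmin : ∀ j, j ≤ x.val → j < Nat.find hex →
        height B₁ (x.val - j) < height B₂ (x.val - j) := by
      intro j hj hlt
      have := Nat.find_min hex hlt
      by_contra hc
      exact this ⟨hj, not_lt.mp hc⟩
    generalize Nat.find hex = i at *
    have hne : i ≠ 0 := by
      rintro rfl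
      simp at hle
      omega
    have hxn := x.isLt
    have hj := hmin (i - 1) (by omega) (by omega)
    have e : x.val - (i - 1) = x.val - i + 1 := by omega
    rw [e] at hj
    have hmin' : ∀ k, x.val - i < k → k ≤ x.val → height B₁ k < height B₂ k := by
      intro k hk1 hk2
      have := hmin (x.val - k) (by omega) (by omega)
      rwa [show x.val - (x.val - k) = k by omega] at this
    have t1 := height_succ B₁ ⟨x.val - i, by omega⟩
    have t2 := height_succ B₂ ⟨x.val - i, by omega⟩
    simp only at t1 t2
    have hy₁ : (⟨x.val - i, by omega⟩ : Fin n) ∉ B₁ := by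
      intro hc
      rw [if_pos hc] at t1
      split_ifs at t2 <;> omega
    have hy₂ : (⟨x.val - i, by omega⟩ : Fin n) ∈ B₂ := by
      by_contra hc
      rw [if_neg hc] at t2
      omega
    refine ⟨⟨x.val - i, by omega⟩, hy₂, hy₁, hcard _ hy₁, fun k => ?_⟩
    have hk := height_exchange hx₁ hy₁ k
    simp only at hk
    have b1 := h₁.2 k
    have b2 := h₂.2 k
    have b3 := hmin' k
    split_ifs at hk <;> omega

/-- The lattice path matroid `M[U, L]`: its bases are the lattice paths between `U` and `L`. -/
def toMatroid (M : LPM n) : Matroid (Fin n) :=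
  Matroid.ofIsBaseOfFinite (E := Set.univ) Set.finite_univ
    (fun B => ∃ A : Finset (Fin n), (A : Set (Fin n)) = B ∧ M.IsPath A)
    ⟨_, M.U, rfl, M.isPath_U⟩
    (by
      rintro _ _ ⟨B₁, rfl, h₁⟩ ⟨B₂, rfl, h₂⟩ x ⟨hx₁, hx₂⟩
      obtain ⟨y, hy₂, hy₁, hy⟩ := M.exists_exchange h₁ h₂ (x := x) (by simpa using hx₁)
        (by simpa using hx₂)
      exact ⟨y, ⟨by simpa using hy₂, by simpa using hy₁⟩, _, by simp, hy⟩)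
    (fun B _ => Set.subset_univ B)

theorem toMatroid_E (M : LPM n) : M.toMatroid.E = Set.univ := rfl

theorem toMatroid_isBase_iff (M : LPM n) (B : Finset (Fin n)) :
    M.toMatroid.IsBase (B : Set (Fin n)) ↔ M.IsPath B := by
  change (∃ A : Finset (Fin n), (A : Set (Fin n)) = B ∧ M.IsPath A) ↔ _
  constructor
  · rintro ⟨A, hA, h⟩
    rwa [← Finset.coe_injective hA]
  · exact fun h => ⟨B, rfl, h⟩

/-- A lattice path matroid determines its two bounding paths, so that `LPM n` is the set of lattice
path matroids on `[n]`. -/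
theorem toMatroid_injective : Function.Injective (toMatroid (n := n)) := by
  intro M M' h
  have key : ∀ B, M.IsPath B ↔ M'.IsPath B := fun B => by
    rw [← toMatroid_isBase_iff, h, toMatroid_isBase_iff]
  refine LPM.ext (eq_of_height_eq fun i => ?_) (eq_of_height_eq fun i => ?_)
  · exact le_antisymm (((key _).1 M.isPath_U).2 i).2 (((key _).2 M'.isPath_U).2 i).2
  · exact le_antisymm (((key _).2 M'.isPath_L).2 i).1 (((key _).1 M.isPath_L).2 i).1

end LPM

/-- `M'` is a quotient of `M`: there is a matroid `N` whose ground set is obtained from that of `M`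
and `M'` by adding a finite set `T` (the range of `Sum.inr`), such that `M = N \ T` and
`M' = N / T`. -/
def IsQuotient {α : Type*} (M' M : Matroid α) : Prop :=
  ∃ (m : ℕ) (N : Matroid (α ⊕ Fin m)),
    N.delete (Set.range Sum.inr) = M.map Sum.inl Sum.inl_injective.injOn ∧
    N.contract (Set.range Sum.inr) = M'.map Sum.inl Sum.inl_injective.injOn

/-- The order of the poset of lattice path matroids: `M' ≤ M` if `M'` is a quotient of `M`. -/
instance {n : ℕ} : LE (LPM n) := ⟨fun M' M => IsQuotient M'.toMatroid M.toMatroid⟩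

/-- The strict order; the cover relation `⋖` is the one of this order. -/
instance {n : ℕ} : LT (LPM n) := ⟨fun M' M => M' ≤ M ∧ M' ≠ M⟩

/-- `C` lists the elements of a maximal chain `x = x₀ ⋖ x₁ ⋖ ⋯ ⋖ x_m = y` of the interval
`[x, y]`, from bottom to top. -/
def IsMaximalChain {n : ℕ} (x y : LPM n) (C : List (LPM n)) : Prop :=
  C.head? = some x ∧ C.getLast? = some y ∧ C.IsChain (· ⋖ ·)

/-- `p = (ℓ, u)` is the good pair label of the cover `M[U', L'] ⋖ M[U, L]`:
`L \ L' = {ℓ}` and `U \ U' = {u}`. -/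
def IsLabel {n : ℕ} (M' M : LPM n) (p : Fin n × Fin n) : Prop :=
  M.L \ M'.L = {p.1} ∧ M.U \ M'.U = {p.2}

/-- `w` is the sequence of labels `(λ(x₀ ⋖ x₁), …, λ(x_{m-1} ⋖ x_m))` of the chain `C`. -/
def IsLabelWord {n : ℕ} (C : List (LPM n)) (w : List (Fin n × Fin n)) : Prop :=
  C.length = w.length + 1 ∧
    ∀ (i : ℕ) (hc : i + 1 < C.length) (hw : i < w.length), IsLabel C[i] C[i + 1] w[i]

/-- `C` is a falling chain of `[x, y]`: a maximal chain none of whose labels is strictly smaller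
than the next one. Labels are compared in the product order of `Fin n × Fin n`. -/
def IsFallingChain {n : ℕ} (x y : LPM n) (C : List (LPM n)) : Prop :=
  IsMaximalChain x y C ∧
    ∃ w : List (Fin n × Fin n), IsLabelWord C w ∧ w.IsChain (fun p q => ¬ p < q)

/-- The uniform matroid `U_{0,n}`. -/
def uniformZero (n : ℕ) : LPM n := ⟨∅, ∅, rfl, fun _ => le_rfl⟩

/-- `M_{k,1} = M[[n] \ {k}, [n] \ {1}]`; the element `1` of `[n]` is `0 : Fin n`. -/
def Mk1 {n : ℕ} [NeZero n] (k : Fin n) : LPM n where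
  U := Finset.univ.erase k
  L := Finset.univ.erase 0
  card_eq := by simp
  noncrossing := fun i => by
    have e : ∀ j : Fin n, height (Finset.univ.erase j) i + (if j.val < i then 1 else 0)
        = height (Finset.univ : Finset (Fin n)) i := by
      intro j
      have e1 : ∀ A : Finset (Fin n), height A i = ∑ z ∈ A, if z.val < i then 1 else 0 := by
        intro A
        exact Finset.card_filter _ _
      rw [e1, e1, Finset.sum_erase_add _ _ (Finset.mem_univ j)]
    have h0 := e 0
    have hk := e k
    have hz : (0 : Fin n).val = 0 := rfl
    split_ifs at h0 hk <;> omega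

/-- The set `FC_k` of falling chains of the interval `[U_{0,n}, M_{k,1}]`. -/
def FC {n : ℕ} [NeZero n] (k : Fin n) : Set (List (LPM n)) :=
  {C | IsFallingChain (uniformZero n) (Mk1 k) C}

end LPMPoset

namespace LPMPoset

/-! ### Heights of lattice paths -/

section Height

variable {n : ℕ}

/-! It suffices to inject `FC b` into `FC c` when `c` is the successor of `b`; the general case
follows by iteration. Upper paths grow along a chain and the top `Mk1 b` omits `b` from its upper
path, so `b` lies in no upper path of a chain in `FC b`. Replacing `c` by `b` in every upper path
(`LPM.shift`) can therefore be undone. It fixes the bottom and sends `Mk1 b` to `Mk1 c`.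

That covers go to covers rests on a description of labeled covers (`LPM.covBy_and_isLabel_iff`):
they are the removals of a step `ℓ` of the lower path and a step `u` of the upper path such that `ℓ`
starts weakly south-east of `u`. The condition is necessary because bases of a quotient sit inside
bases of the matroid and conversely; when it fails, an explicit path violates this. It is sufficient
because the paths of `M`, together with the paths of `M'` enlarged by one new element, then satisfy
basis exchange and give a matroid witnessing the quotient.

The shift keeps the height at which `u` starts and can only move that start west, so the condition
survives. On labels it applies the transposition of `b` and `c` to the second coordinate. No label
has second coordinate `b`, and `b`, `c` are adjacent, so this preserves and reflects order, and
falling chains stay falling. -/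

theorem height_mono (B : Finset (Fin n)) {s t : ℕ} (h : s ≤ t) : height B s ≤ height B t :=
  Finset.card_le_card fun x hx => by
    simp only [Finset.mem_filter] at hx ⊢
    exact ⟨hx.1, hx.2.trans_le h⟩

theorem height_of_le (B : Finset (Fin n)) {i : ℕ} (h : n ≤ i) : height B i = height B n := by
  unfold height
  congr 1
  ext x
  have := x.isLt
  simp only [Finset.mem_filter]
  constructor <;> rintro ⟨hx, _⟩ <;> exact ⟨hx, by omega⟩

theorem height_succ_le (B : Finset (Fin n)) (t : ℕ) : height B (t + 1) ≤ height B t + 1 := by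
  rcases Nat.lt_or_ge t n with h | h
  · have := height_succ B ⟨t, h⟩
    simp only at this
    split_ifs at this <;> omega
  · rw [height_of_le B h, height_of_le B (h.trans (Nat.le_succ t))]
    omega

theorem height_le_add (B : Finset (Fin n)) (s d : ℕ) : height B (s + d) ≤ height B s + d := by
  induction d with
  | zero => simp
  | succ d ih =>
    have := height_succ_le B (s + d)
    rw [← Nat.add_assoc]
    omega

theorem height_erase {B : Finset (Fin n)} {x : Fin n} (hx : x ∈ B) (i : ℕ) :
    height (B.erase x) i + (if x.val < i then 1 else 0) = height B i := by
  simp only [height, Finset.card_filter]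
  exact Finset.sum_erase_add B _ hx

theorem height_insert {B : Finset (Fin n)} {x : Fin n} (hx : x ∉ B) (i : ℕ) :
    height (insert x B) i = height B i + (if x.val < i then 1 else 0) := by
  rw [← height_erase (Finset.mem_insert_self x B) i, Finset.erase_insert hx]

/-- A path that rises more than another one between two positions has a private north step there. -/
theorem exists_mem_of_height_lt {A B : Finset (Fin n)} {p q : ℕ} (hpq : p ≤ q)
    (h : height A q + height B p < height B q + height A p) :
    ∃ y ∈ B, y ∉ A ∧ p ≤ y.val ∧ y.val < q := by
  by_contra! hc
  have key : ∀ d, p + d ≤ q → height B (p + d) + height A p ≤ height A (p + d) + height B p := by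
    intro d
    induction d with
    | zero => intro _; simp; omega
    | succ d ih =>
      intro hd
      have ih := ih (by omega)
      rw [← Nat.add_assoc]
      rcases Nat.lt_or_ge (p + d) n with hn | hn
      · have h1 := height_succ A ⟨p + d, hn⟩
        have h2 := height_succ B ⟨p + d, hn⟩
        have h3 := hc ⟨p + d, hn⟩
        simp only at h1 h2 h3
        by_cases hA : (⟨p + d, hn⟩ : Fin n) ∈ A
        · rw [if_pos hA] at h1
          split_ifs at h2 <;> omega
        · have hB : (⟨p + d, hn⟩ : Fin n) ∉ B := fun hB => by
            have := h3 hB hA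
            omega
          rw [if_neg hA] at h1
          rw [if_neg hB] at h2
          omega
      · rw [height_of_le A hn, height_of_le B hn] at ih
        rw [height_of_le A (hn.trans (Nat.le_succ _)), height_of_le B (hn.trans (Nat.le_succ _))]
        exact ih
  have := key (q - p) (by omega)
  rw [Nat.add_sub_cancel' hpq] at this
  omega

/-- Every function with unit or zero steps is the height function of a path. -/
theorem exists_height_eq (n : ℕ) (g : ℕ → ℕ) (h0 : g 0 = 0) (hle : ∀ t, g t ≤ g (t + 1))
    (hs : ∀ t, g (t + 1) ≤ g t + 1) : ∃ B : Finset (Fin n), ∀ t ≤ n, height B t = g t := by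
  refine ⟨Finset.univ.filter fun x => g (x.val + 1) = g x.val + 1, fun t => ?_⟩
  induction t with
  | zero => intro _; rw [height_zero, h0]
  | succ t ih =>
    intro ht
    have h1 := height_succ (Finset.univ.filter fun x : Fin n => g (x.val + 1) = g x.val + 1) ⟨t, ht⟩
    simp only [Finset.mem_filter, Finset.mem_univ, true_and] at h1
    rw [h1, ih (by omega)]
    have := hle t
    have := hs t
    split_ifs <;> omega

theorem exists_last {P : ℕ → Prop} (h0 : P 0) (x : ℕ) :
    ∃ p ≤ x, P p ∧ ∀ t, p < t → t ≤ x → ¬ P t := by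
  induction x with
  | zero => exact ⟨0, le_rfl, h0, fun t h1 h2 => by omega⟩
  | succ x ih =>
    by_cases h : P (x + 1)
    · exact ⟨x + 1, le_rfl, h, fun t h1 h2 => by omega⟩
    · obtain ⟨p, hp, hP, hmax⟩ := ih
      refine ⟨p, by omega, hP, fun t h1 h2 => ?_⟩
      rcases Nat.lt_or_ge x t with h3 | h3
      · rwa [show t = x + 1 by omega]
      · exact hmax t h1 h3

theorem exists_first {P : ℕ → Prop} {x m : ℕ} (hx : x ≤ m) (hm : P m) :
    ∃ q, x ≤ q ∧ q ≤ m ∧ P q ∧ ∀ t, x ≤ t → t < q → ¬ P t := by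
  classical
  have hex : ∃ q, x ≤ q ∧ P q := ⟨m, hx, hm⟩
  exact ⟨Nat.find hex, (Nat.find_spec hex).1, Nat.find_le ⟨hx, hm⟩, (Nat.find_spec hex).2,
    fun t h1 h2 h3 => Nat.find_min hex h2 ⟨h1, h3⟩⟩

end Height

/-! ### Bases of matroid quotients -/

section Quotient

variable {α : Type*} {M M' : Matroid α}

/-- Deleting `T` computes closures in `N`, contracting `T` computes them after adjoining `T`, and
closure in `N` is monotone. -/
theorem IsQuotient.closure_subset (h : IsQuotient M' M) (A : Set α) :
    M.closure A ⊆ M'.closure A := by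
  obtain ⟨m, N, hd, hc⟩ := h
  intro x hx
  have h1 : (Sum.inl x : α ⊕ Fin m) ∈ (N.delete (Set.range Sum.inr)).closure (Sum.inl '' A) := by
    rw [hd, Matroid.map_closure_eq, Set.preimage_image_eq _ Sum.inl_injective]
    exact Set.mem_image_of_mem _ hx
  have h2 : (Sum.inl x : α ⊕ Fin m) ∈ (N.contract (Set.range Sum.inr)).closure (Sum.inl '' A) := by
    rw [Matroid.contract_closure_eq]
    rw [Matroid.delete_closure_eq] at h1
    exact ⟨N.closure_subset_closure (Set.sdiff_subset.trans Set.subset_union_left) h1.1, h1.2⟩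
  rw [hc, Matroid.map_closure_eq, Set.preimage_image_eq _ Sum.inl_injective] at h2
  obtain ⟨y, hy, hyx⟩ := h2
  rwa [← Sum.inl_injective hyx]

/-- Closures grow in the quotient, so a base of `M` still spans `M'`. -/
theorem IsQuotient.exists_isBase_subset (h : IsQuotient M' M) (hE : M.E = M'.E) {B : Set α}
    (hB : M.IsBase B) : ∃ B', M'.IsBase B' ∧ B' ⊆ B := by
  have hBE : B ⊆ M'.E := hE ▸ hB.subset_ground
  refine Matroid.Spanning.exists_isBase_subset ?_
  rw [Matroid.spanning_iff_ground_subset_closure hBE, ← hE, ← hB.closure_eq]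
  exact h.closure_subset B

/-- Closures are smaller in `M`, so a set independent in `M'` stays independent in `M`. -/
theorem IsQuotient.exists_isBase_superset (h : IsQuotient M' M) (hE : M.E = M'.E) {B' : Set α}
    (hB : M'.IsBase B') : ∃ B, M.IsBase B ∧ B' ⊆ B := by
  have hBE : B' ⊆ M.E := hE ▸ hB.subset_ground
  refine Matroid.Indep.exists_isBase_superset ?_
  rw [Matroid.indep_iff_forall_notMem_closure_sdiff hBE]
  intro e he hcl
  exact hB.indep.notMem_closure_sdiff_of_mem he (h.closure_subset _ hcl)

end Quotient

/-! ### Quotients of lattice path matroids and good pairs -/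

namespace LPM

variable {n : ℕ} {M M' : LPM n} {ℓ u : Fin n}

theorem exists_isPath_subset (h : M' ≤ M) {B : Finset (Fin n)} (hB : M.IsPath B) :
    ∃ B', M'.IsPath B' ∧ B' ⊆ B := by
  obtain ⟨S, hS, hSB⟩ := IsQuotient.exists_isBase_subset h rfl ((M.toMatroid_isBase_iff B).2 hB)
  lift S to Finset (Fin n) using Set.toFinite S
  exact ⟨S, (M'.toMatroid_isBase_iff S).1 hS, by simpa using hSB⟩

theorem exists_isPath_superset (h : M' ≤ M) {B' : Finset (Fin n)} (hB : M'.IsPath B') :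
    ∃ B, M.IsPath B ∧ B' ⊆ B := by
  obtain ⟨S, hS, hSB⟩ := IsQuotient.exists_isBase_superset h rfl ((M'.toMatroid_isBase_iff B').2 hB)
  lift S to Finset (Fin n) using Set.toFinite S
  exact ⟨S, (M.toMatroid_isBase_iff S).1 hS, by simpa using hSB⟩

theorem eq_of_isPath_iff (h : ∀ B, M.IsPath B ↔ M'.IsPath B) : M = M' := by
  refine LPM.ext (eq_of_height_eq fun i => ?_) (eq_of_height_eq fun i => ?_)
  · exact le_antisymm (((h _).1 M.isPath_U).2 i).2 (((h _).2 M'.isPath_U).2 i).2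
  · exact le_antisymm (((h _).2 M'.isPath_L).2 i).1 (((h _).1 M.isPath_L).2 i).1

/-- If the ranks agreed, the containments between bases would be equalities and the two matroids
would coincide. This makes a quotient of corank one automatically a cover. -/
theorem card_lt_of_lt (h : M' < M) : M'.U.card < M.U.card := by
  have hle : M' ≤ M := h.1
  obtain ⟨A, hA, hAU⟩ := exists_isPath_subset hle M.isPath_U
  refine lt_of_le_of_ne (hA.1 ▸ Finset.card_le_card hAU) fun hc => h.2 (eq_of_isPath_iff fun B => ?_)
  constructor
  · intro hB
    obtain ⟨B', hB', hs⟩ := exists_isPath_superset hle hB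
    rwa [Finset.eq_of_subset_of_card_le hs (by rw [hB.1, hB'.1, hc])]
  · intro hB
    obtain ⟨B', hB', hs⟩ := exists_isPath_subset hle hB
    rwa [← Finset.eq_of_subset_of_card_le hs (by rw [hB.1, hB'.1, hc])]

theorem isPath_of_height {B : Finset (Fin n)}
    (h : ∀ i ≤ n, height M.L i ≤ height B i ∧ height B i ≤ height M.U i) : M.IsPath B := by
  have hn := h n le_rfl
  refine ⟨?_, fun i => ?_⟩
  · have := M.card_eq
    simp only [height_top] at hn
    omega
  · rcases le_total i n with hi | hi
    · exact h i hi
    · simpa only [height_of_le _ hi] using hn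

/-- `(ℓ, u)` is a good pair of `M[U, L]`: the start of the north step `ℓ` of the lower path is
weakly south-east of the start of the north step `u` of the upper path. -/
structure GoodPair (M : LPM n) (ℓ u : Fin n) : Prop where
  mem_L : ℓ ∈ M.L
  mem_U : u ∈ M.U
  north_le : height M.L ℓ.val ≤ height M.U u.val
  east_le : u.val + height M.L ℓ.val ≤ ℓ.val + height M.U u.val

/-- `M'` is obtained from `M` by removing the north step `ℓ` of the lower path and the north step
`u` of the upper path. -/
structure IsRemoval (M' M : LPM n) (ℓ u : Fin n) : Prop where
  mem_L : ℓ ∈ M.L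
  mem_U : u ∈ M.U
  L_eq : M'.L = M.L.erase ℓ
  U_eq : M'.U = M.U.erase u

theorem IsRemoval.height_L (h : IsRemoval M' M ℓ u) (i : ℕ) :
    height M'.L i + (if ℓ.val < i then 1 else 0) = height M.L i := by
  rw [h.L_eq, height_erase h.mem_L]

theorem IsRemoval.height_U (h : IsRemoval M' M ℓ u) (i : ℕ) :
    height M'.U i + (if u.val < i then 1 else 0) = height M.U i := by
  rw [h.U_eq, height_erase h.mem_U]

theorem IsRemoval.card_U (h : IsRemoval M' M ℓ u) : M'.U.card + 1 = M.U.card := by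
  rw [h.U_eq, Finset.card_erase_add_one h.mem_U]

/-- Otherwise some path `B` of `M` touches the upper path just after `u` and the lower path just
before `ℓ`, with `u < ℓ`. A path of `M'` inside `B` arises by deleting one step `e`. The bound at `u
+ 1` forces `e ≤ u`, and the path is then too low at `ℓ`. -/
theorem IsRemoval.north_le (h : IsRemoval M' M ℓ u) (hq : M' ≤ M) :
    height M.L ℓ.val ≤ height M.U u.val := by
  by_contra! hc
  have hul : u.val < ℓ.val := by
    by_contra! hlu
    have := height_mono M.L hlu
    have := M.noncrossing u.val
    omega
  have hsu := height_succ M.U u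
  rw [if_pos h.mem_U] at hsu
  -- Follow the upper path through the step `u`, run east until meeting the lower path, then follow
  -- the lower path.
  obtain ⟨B, hB⟩ := exists_height_eq n
    (fun t => max (min (height M.U t) (height M.U (u.val + 1))) (height M.L t))
    (by simp [height_zero])
    (fun t => by
      have := height_mono M.U (Nat.le_succ t)
      have := height_mono M.L (Nat.le_succ t)
      simp only [Nat.succ_eq_add_one] at *
      omega)
    (fun t => by
      have := height_succ_le M.U t
      have := height_succ_le M.L t
      omega)
  have hBM : M.IsPath B := isPath_of_height fun i hi => by
    rw [hB i hi]
    have := M.noncrossing i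
    omega
  obtain ⟨B', hB', hs⟩ := exists_isPath_subset hq hBM
  have hcard : B'.card + 1 = B.card := by rw [hB'.1, hBM.1, h.card_U]
  obtain ⟨e, he, rfl⟩ : ∃ e ∈ B, B' = B.erase e := by
    obtain ⟨e, he⟩ := Finset.card_eq_one.1 (show (B \ B').card = 1 by
      rw [Finset.card_sdiff_of_subset hs]; omega)
    have heB : e ∈ B \ B' := by simp [he]
    refine ⟨e, (Finset.mem_sdiff.1 heB).1, ?_⟩
    rw [← Finset.sdiff_singleton_eq_erase, ← he, Finset.sdiff_sdiff_eq_self hs]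
  have h1 := height_erase he (u.val + 1)
  have h2 := height_erase he ℓ.val
  have h3 := hB (u.val + 1) u.isLt
  have h4 := hB ℓ.val ℓ.isLt.le
  have h5 := (hB'.2 (u.val + 1)).2
  have h6 := (hB'.2 ℓ.val).1
  have h7 := h.height_U (u.val + 1)
  have h8 := h.height_L ℓ.val
  have h9 := M.noncrossing (u.val + 1)
  simp only [lt_irrefl, if_false, Nat.lt_succ_self, if_true] at h7 h8
  split_ifs at h1 h2 <;> omega

/-- The dual argument: some path `B'` of `M'` touches the lower path after `ℓ` and the upper path at
`u`, with `ℓ < u`. A path of `M` containing it must add a step `e ≤ ℓ` to clear the lower path, and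
then exceeds the upper path at `u`. -/
theorem IsRemoval.east_le (h : IsRemoval M' M ℓ u) (hq : M' ≤ M) :
    u.val + height M.L ℓ.val ≤ ℓ.val + height M.U u.val := by
  by_contra! hc
  have hlu : ℓ.val < u.val := by
    by_contra! hul
    have h1 := height_le_add M.L u.val (ℓ.val - u.val)
    rw [Nat.add_sub_cancel' hul] at h1
    have := M.noncrossing u.val
    omega
  have hsl := height_succ M.L ℓ
  rw [if_pos h.mem_L] at hsl
  have hl0 := h.height_L ℓ.val
  have hl1 := h.height_L (ℓ.val + 1)
  have hu0 := h.height_U u.val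
  simp only [lt_irrefl, if_false, Nat.lt_succ_self, if_true] at hl0 hl1 hu0
  -- Follow the lower path of `M'` past `ℓ`, then climb north along a diagonal in the (position,
  -- height) coordinates until meeting the upper path of `M'`. Before `ℓ + 1` the diagonal,
  -- truncated at zero, lies weakly below the lower path and plays no role.
  obtain ⟨B', hB'⟩ := exists_height_eq n
    (fun t => min (max (height M'.L t) (t + height M.L ℓ.val - (ℓ.val + 1))) (height M'.U t))
    (by simp [height_zero])
    (fun t => by
      have := height_mono M'.U (Nat.le_succ t)
      have := height_mono M'.L (Nat.le_succ t)
      simp only [Nat.succ_eq_add_one] at *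
      omega)
    (fun t => by
      have := height_succ_le M'.U t
      have := height_succ_le M'.L t
      omega)
  have hBM : M'.IsPath B' := isPath_of_height fun i hi => by
    rw [hB' i hi]
    have := M'.noncrossing i
    omega
  obtain ⟨B, hB, hs⟩ := exists_isPath_superset hq hBM
  have hcard : B'.card + 1 = B.card := by rw [hBM.1, hB.1, h.card_U]
  obtain ⟨e, he, rfl⟩ : ∃ e, e ∉ B' ∧ B = insert e B' := by
    obtain ⟨e, he⟩ := Finset.card_eq_one.1 (show (B \ B').card = 1 by
      rw [Finset.card_sdiff_of_subset hs]; omega)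
    have heB : e ∈ B \ B' := by simp [he]
    refine ⟨e, (Finset.mem_sdiff.1 heB).2, ?_⟩
    rw [Finset.insert_eq, ← he, Finset.sdiff_union_of_subset hs]
  have h1 := height_insert he (ℓ.val + 1)
  have h2 := height_insert he u.val
  have h3 := hB' (ℓ.val + 1) ℓ.isLt
  have h4 := hB' u.val u.isLt.le
  have h5 := (hB.2 (ℓ.val + 1)).1
  have h6 := (hB.2 u.val).2
  split_ifs at h1 h2 <;> omega

theorem IsRemoval.goodPair (h : IsRemoval M' M ℓ u) (hq : M' ≤ M) : M.GoodPair ℓ u :=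
  ⟨h.mem_L, h.mem_U, h.north_le hq, h.east_le hq⟩

/-! ### The single-element extension of a good pair -/

/-- If `y < x`, the heights rise by one only on `(y, x]`, where there is room below the upper path.
If `x < y`, they drop by one only on `(x, y]`, where there is room above the lower path. -/
theorem isPath_exchange {B : Finset (Fin n)} {x y : Fin n} (hB : M.IsPath B) (hx : x ∈ B)
    (hy : y ∉ B) {p q : ℕ} (hp : ∀ t, p < t → t ≤ x.val → height B t ≠ height M.U t)
    (hq : ∀ t, x.val + 1 ≤ t → t < q → height B t ≠ height M.L t)
    (hpy : p ≤ y.val) (hyq : y.val < q) : M.IsPath (insert y (B.erase x)) :=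
  isPath_of_height fun i _ => by
    have h1 := height_exchange hx hy i
    have h2 := hB.2 i
    have h3 := hp i
    have h4 := hq i
    split_ifs at h1 <;> omega

/-- Here `p` is the last contact with the upper path up to `x`, and `q` the first contact with the
lower path after `x`. By `isPath_exchange` every new step in `[p, q)` can replace `x`, so the
exchange lemmas reduce to counting heights at `p` and `q`. -/
theorem exists_tight_interval {B : Finset (Fin n)} (x : Fin n) :
    ∃ p q : ℕ, p ≤ x.val ∧ x.val + 1 ≤ q ∧ q ≤ n ∧
      (M.IsPath B → height B p = height M.U p ∧ height B q = height M.L q) ∧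
      (∀ t, p < t → t ≤ x.val → height B t ≠ height M.U t) ∧
      (∀ t, x.val + 1 ≤ t → t < q → height B t ≠ height M.L t) := by
  obtain ⟨p, hp, hP, hp'⟩ := exists_last (P := fun t => height B t = height M.U t)
    (by simp [height_zero]) x.val
  obtain ⟨q, hq, hqn, hQ, hq'⟩ := exists_first
    (P := fun t => M.IsPath B → height B t = height M.L t) (Nat.succ_le_of_lt x.isLt)
    (fun hB => by rw [height_top, hB.1, height_top, M.card_eq])
  exact ⟨p, q, hp, hq, hqn, fun hB => ⟨hP, hQ hB⟩, hp',
    fun t h1 h2 h3 => hq' t h1 h2 fun _ => h3⟩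

/-- The first alternative is an exchange of `x` for the new element of the extension. -/
theorem IsRemoval.exchange_of_mem_upper (h : IsRemoval M' M ℓ u) {B₁ B₂ : Finset (Fin n)}
    (h₁ : M.IsPath B₁) (h₂ : M'.IsPath B₂) {x : Fin n} (hx₁ : x ∈ B₁) (hx₂ : x ∉ B₂) :
    M'.IsPath (B₁.erase x) ∨ ∃ y ∈ B₂, y ∉ B₁ ∧ M.IsPath (insert y (B₁.erase x)) := by
  obtain ⟨p, q, hpx, hxq, hqn, htight, hp, hq⟩ := M.exists_tight_interval (B := B₁) x
  obtain ⟨hpt, hqt⟩ := htight h₁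
  have ep := height_erase hx₁ p
  have eq := height_erase hx₁ q
  rw [if_neg (by omega)] at ep
  rw [if_pos (by omega)] at eq
  have up := h.height_U p
  have lq := h.height_L q
  have b1 := (h₂.2 p).2
  have b2 := (h₂.2 q).1
  rcases Nat.lt_or_ge (height (B₁.erase x) q + height B₂ p)
    (height B₂ q + height (B₁.erase x) p) with hlt | hge
  · obtain ⟨y, hy₂, hy₁, hpy, hyq⟩ := exists_mem_of_height_lt (by omega) hlt
    have hy : y ∉ B₁ := fun hy => hy₁ (Finset.mem_erase.2 ⟨by rintro rfl; exact hx₂ hy₂, hy⟩)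
    exact Or.inr ⟨y, hy₂, hy, isPath_exchange h₁ hx₁ hy hp hq hpy hyq⟩
  -- If `B₂` rises no more than `B₁.erase x` on `[p, q]`, the boundary heights force `ℓ < q` and `p
  -- ≤ u`. Then `B₁.erase x` fits between the paths of `M'`: before `q` it has slack above the lower
  -- path, and from `q` on the lower path has already dropped.
  · left
    have hq' : ℓ.val < q := by
      by_contra hc
      rw [if_neg hc] at lq
      omega
    have hp' : ¬ u.val < p := by
      intro hc
      rw [if_pos hc] at up
      split_ifs at lq; omega
    refine isPath_of_height fun i _ => ?_
    have e := height_erase hx₁ i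
    have c1 := h.height_U i
    have c2 := h.height_L i
    have c3 := h₁.2 i
    have c4 := hp i
    have c5 := hq i
    split_ifs at e c1 c2 <;> omega

theorem IsRemoval.exchange_of_mem_lower (h : IsRemoval M' M ℓ u) (hg : M.GoodPair ℓ u)
    {B₁ B₂ : Finset (Fin n)} (h₁ : M'.IsPath B₁) (h₂ : M.IsPath B₂) {x : Fin n} (hx₁ : x ∈ B₁)
    (hx₂ : x ∉ B₂) : ∃ y ∈ B₂, y ∉ B₁ ∧ M'.IsPath (insert y (B₁.erase x)) := by
  obtain ⟨p, q, hpx, hxq, hqn, htight, hp, hq⟩ := M'.exists_tight_interval (B := B₁) x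
  obtain ⟨hpt, hqt⟩ := htight h₁
  have ep := height_erase hx₁ p
  have eq := height_erase hx₁ q
  rw [if_neg (by omega)] at ep
  rw [if_pos (by omega)] at eq
  have up := h.height_U p
  have lq := h.height_L q
  have b1 := (h₂.2 p).2
  have b2 := (h₂.2 q).1
  obtain ⟨y, hy₂, hy₁, hpy, hyq⟩ : ∃ y ∈ B₂, y ∉ B₁.erase x ∧ p ≤ y.val ∧ y.val < q := by
    refine exists_mem_of_height_lt (by omega) ?_
    by_contra! hc
    -- Failure of the inequality forces `u < p` and `q ≤ ℓ`. Then `north_le` bounds the lower path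
    -- at `q` strictly below the upper path of `M` at `p`, although `B₁` climbs at least one step,
    -- `x`, in between.
    have hup : u.val < p := by
      by_contra hup
      rw [if_neg hup] at up
      split_ifs at lq <;> omega
    have hql : ¬ ℓ.val < q := by
      intro hql
      rw [if_pos hql] at lq
      split_ifs at up; omega
    rw [if_pos hup] at up
    rw [if_neg hql] at lq
    have m1 := height_mono M.L (show q ≤ ℓ.val by omega)
    have m2 := height_mono M.U (show u.val + 1 ≤ p by omega)
    have hsu := height_succ M.U u
    rw [if_pos hg.mem_U] at hsu
    have := hg.north_le
    have s1 := height_succ B₁ x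
    rw [if_pos hx₁] at s1
    have m3 := height_mono B₁ hpx
    have m4 := height_mono B₁ hxq
    omega
  have hy : y ∉ B₁ := fun hy => hy₁ (Finset.mem_erase.2 ⟨by rintro rfl; exact hx₂ hy₂, hy⟩)
  exact ⟨y, hy₂, hy, isPath_exchange h₁ hx₁ hy hp hq hpy hyq⟩

/-- Exchange of the new element for an old one. A step can be added after the last contact `p` of
`B₁` with the upper path of `M` and before the first point `q` where `B₁` falls below the lower path
of `M`. -/
theorem IsRemoval.exists_insert (h : IsRemoval M' M ℓ u) (hg : M.GoodPair ℓ u)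
    {B₁ B₂ : Finset (Fin n)} (h₁ : M'.IsPath B₁) (h₂ : M.IsPath B₂) :
    ∃ y ∈ B₂, y ∉ B₁ ∧ M.IsPath (insert y B₁) := by
  obtain ⟨p, hpn, hpt, hp⟩ := exists_last (P := fun t => height B₁ t = height M.U t)
    (by simp [height_zero]) n
  obtain ⟨q, -, hqn, hqt, hq⟩ := exists_first
    (P := fun t => height B₁ t + 1 = height M.L t) (Nat.zero_le n)
    (by rw [height_top, h₁.1, height_top, ← M.card_eq, h.card_U])
  have hpu : p ≤ u.val := by
    have := h.height_U p
    have := h₁.2 p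
    split_ifs at * <;> omega
  have hql : ℓ.val < q := by
    have := h.height_L q
    have := h₁.2 q
    split_ifs at * <;> omega
  -- If `q ≤ p`, comparing position minus height, which never decreases along a path, at `u`, `p`,
  -- `q` and `ℓ + 1` contradicts `east_le`.
  have hpq : p < q := by
    by_contra! hc
    have hsl := height_succ M.L ℓ
    rw [if_pos hg.mem_L] at hsl
    have e1 := height_le_add M.U p (u.val - p)
    have e2 := height_le_add M.L (ℓ.val + 1) (q - (ℓ.val + 1))
    have e3 := height_le_add B₁ q (p - q)
    rw [Nat.add_sub_cancel' hpu] at e1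
    rw [Nat.add_sub_cancel' hql] at e2
    rw [Nat.add_sub_cancel' hc] at e3
    have := hg.east_le
    omega
  have b1 := (h₂.2 p).2
  have b2 := (h₂.2 q).1
  obtain ⟨y, hy₂, hy, hpy, hyq⟩ := exists_mem_of_height_lt (A := B₁) (B := B₂) hpq.le (by omega)
  refine ⟨y, hy₂, hy, isPath_of_height fun i hi => ?_⟩
  have e := height_insert hy i
  have c1 := h.height_U i
  have c2 := h.height_L i
  have c3 := h₁.2 i
  have c4 := hp i
  have c5 := hq i (Nat.zero_le i)
  split_ifs at e c1 c2 <;> omega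

/-- The bases of the extension by one element: the paths of `M`, and the paths of `M'` together
with the new element. -/
def IsExtensionBase (M' M : LPM n) (S : Set (Fin n ⊕ Fin 1)) : Prop :=
  (∃ B : Finset (Fin n), M.IsPath B ∧ S = Sum.inl '' (B : Set (Fin n))) ∨
    ∃ B : Finset (Fin n), M'.IsPath B ∧ S = insert (Sum.inr 0) (Sum.inl '' (B : Set (Fin n)))

theorem image_inl_exchange {B : Finset (Fin n)} {x y : Fin n} :
    insert (Sum.inl y) (Sum.inl '' (B : Set (Fin n)) \ {Sum.inl x}) =
      (Sum.inl '' ((insert y (B.erase x) : Finset (Fin n)) : Set (Fin n)) : Set (Fin n ⊕ Fin 1)) := by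
  ext (z | z) <;> simp

theorem insert_inr_image_inl_exchange {B : Finset (Fin n)} {x y : Fin n} :
    insert (Sum.inl y) (insert (Sum.inr 0) (Sum.inl '' (B : Set (Fin n))) \ {Sum.inl x}) =
      (insert (Sum.inr 0) (Sum.inl '' ((insert y (B.erase x) : Finset (Fin n)) : Set (Fin n))) :
        Set (Fin n ⊕ Fin 1)) := by
  ext (z | z) <;> simp

theorem IsRemoval.exchange_isExtensionBase (h : IsRemoval M' M ℓ u) (hg : M.GoodPair ℓ u) :
    Matroid.ExchangeProperty (IsExtensionBase M' M) := by
  rintro _ _ (⟨B₁, h₁, rfl⟩ | ⟨B₁, h₁, rfl⟩) (⟨B₂, h₂, rfl⟩ | ⟨B₂, h₂, rfl⟩) (x | x) ⟨hx₁, hx₂⟩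
  · obtain ⟨y, hy₂, hy₁, hy⟩ := M.exists_exchange h₁ h₂ (x := x) (by simpa using hx₁)
      (by simpa using hx₂)
    exact ⟨Sum.inl y, by simp [hy₁, hy₂], Or.inl ⟨_, hy, image_inl_exchange⟩⟩
  · simp at hx₁
  · rcases h.exchange_of_mem_upper h₁ h₂ (x := x) (by simpa using hx₁) (by simpa using hx₂) with
      hB | ⟨y, hy₂, hy₁, hy⟩
    · refine ⟨Sum.inr 0, by simp, Or.inr ⟨_, hB, ?_⟩⟩
      ext (z | z) <;> simp
    · exact ⟨Sum.inl y, by simp [hy₁, hy₂], Or.inl ⟨_, hy, image_inl_exchange⟩⟩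
  · simp at hx₁
  · obtain ⟨y, hy₂, hy₁, hy⟩ := h.exchange_of_mem_lower hg h₁ h₂ (x := x) (by simpa using hx₁)
      (by simpa using hx₂)
    exact ⟨Sum.inl y, by simp [hy₁, hy₂], Or.inr ⟨_, hy, insert_inr_image_inl_exchange⟩⟩
  · obtain ⟨y, hy₂, hy₁, hy⟩ := h.exists_insert hg h₁ h₂
    refine ⟨Sum.inl y, by simp [hy₁, hy₂], Or.inl ⟨_, hy, ?_⟩⟩
    ext (z | z) <;> simp [Fin.fin_one_eq_zero]
  · obtain ⟨y, hy₂, hy₁, hy⟩ := M'.exists_exchange h₁ h₂ (x := x) (by simpa using hx₁)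
      (by simpa using hx₂)
    exact ⟨Sum.inl y, by simp [hy₁, hy₂], Or.inr ⟨_, hy, insert_inr_image_inl_exchange⟩⟩
  · simp [Fin.fin_one_eq_zero] at hx₂

/-- The new element is neither a loop nor a coloop of the extension, so the bases of its deletion
are those avoiding it, and the bases of its contraction come from those containing it. -/
theorem IsRemoval.le (h : IsRemoval M' M ℓ u) (hg : M.GoodPair ℓ u) : M' ≤ M := by
  let N : Matroid (Fin n ⊕ Fin 1) := Matroid.ofIsBaseOfFinite (E := Set.univ) Set.finite_univ
    (IsExtensionBase M' M) ⟨_, Or.inl ⟨_, M.isPath_U, rfl⟩⟩ (h.exchange_isExtensionBase hg)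
    (fun B _ => Set.subset_univ B)
  have hN : ∀ S, N.IsBase S ↔ IsExtensionBase M' M S := fun S => Iff.rfl
  have hE : N.E = Set.univ := rfl
  have hco : N.Coindep (Set.range Sum.inr) := by
    rw [Matroid.coindep_iff_exists (Set.subset_univ _)]
    refine ⟨_, (hN _).2 (Or.inl ⟨_, M.isPath_U, rfl⟩), ?_⟩
    rintro _ ⟨x, _, rfl⟩
    simp [hE]
  have hin : N.Indep (Set.range Sum.inr) := by
    refine Matroid.IsBase.indep ((hN _).2 (Or.inr ⟨_, M'.isPath_U, rfl⟩)) |>.subset ?_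
    rintro _ ⟨x, rfl⟩
    simp [Fin.fin_one_eq_zero]
  have hpath : ∀ (K : LPM n) (S : Set (Fin n)),
      K.toMatroid.IsBase S ↔ ∃ B : Finset (Fin n), K.IsPath B ∧ S = B := by
    intro K S
    constructor
    · intro hS
      lift S to Finset (Fin n) using Set.toFinite S
      exact ⟨S, (K.toMatroid_isBase_iff S).1 hS, rfl⟩
    · rintro ⟨B, hB, rfl⟩
      exact (K.toMatroid_isBase_iff B).2 hB
  have hground : (Set.univ \ Set.range Sum.inr : Set (Fin n ⊕ Fin 1)) = Sum.inl '' Set.univ := by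
    ext (z | z) <;> simp
  refine ⟨1, N, Matroid.ext_isBase hground fun S _ => ?_, Matroid.ext_isBase hground fun S _ => ?_⟩
  · rw [hco.delete_isBase_iff, Matroid.map_isBase_iff, hN]
    constructor
    · rintro ⟨⟨B, hB, rfl⟩ | ⟨B, hB, rfl⟩, hd⟩
      · exact ⟨_, (hpath M _).2 ⟨B, hB, rfl⟩, rfl⟩
      · exact absurd ⟨0, rfl⟩ (Set.disjoint_left.1 hd (Set.mem_insert _ _))
    · rintro ⟨S, hS, rfl⟩
      obtain ⟨B, hB, rfl⟩ := (hpath M S).1 hS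
      refine ⟨Or.inl ⟨B, hB, rfl⟩, Set.disjoint_left.2 ?_⟩
      rintro _ ⟨x, _, rfl⟩
      simp
  · rw [hin.contract_isBase_iff, Matroid.map_isBase_iff, hN]
    have hr : (Set.range Sum.inr : Set (Fin n ⊕ Fin 1)) = {Sum.inr 0} := by
      ext (z | z) <;> simp [Fin.fin_one_eq_zero]
    rw [hr, Set.union_singleton]
    constructor
    · rintro ⟨⟨B, hB, hS⟩ | ⟨B, hB, hS⟩, hd⟩
      · have : (Sum.inr 0 : Fin n ⊕ Fin 1) ∈ Sum.inl '' (B : Set (Fin n)) :=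
          hS ▸ Set.mem_insert _ _
        simp at this
      · refine ⟨_, (hpath M' _).2 ⟨B, hB, rfl⟩, ?_⟩
        have hd := Set.disjoint_singleton_right.1 hd
        rw [← Set.insert_sdiff_self_of_notMem hd, hS, Set.insert_sdiff_self_of_notMem (by simp)]
    · rintro ⟨S, hS, rfl⟩
      obtain ⟨B, hB, rfl⟩ := (hpath M' S).1 hS
      exact ⟨Or.inr ⟨B, hB, rfl⟩, by simp⟩

theorem eq_erase_of_sdiff_eq_singleton {A B : Finset (Fin n)} {x : Fin n} (h : A \ B = {x})
    (hc : B.card < A.card) : x ∈ A ∧ B = A.erase x := by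
  have hx : x ∈ A \ B := by simp [h]
  have hxA := (Finset.mem_sdiff.1 hx).1
  refine ⟨hxA, (Finset.eq_of_subset_of_card_le (fun y hy => ?_) ?_).symm⟩
  · obtain ⟨hyx, hyA⟩ := Finset.mem_erase.1 hy
    by_contra hyB
    have : y ∈ A \ B := Finset.mem_sdiff.2 ⟨hyA, hyB⟩
    rw [h, Finset.mem_singleton] at this
    exact hyx this
  · rw [Finset.card_erase_of_mem hxA]
    omega

/-! ### Labeled covers as removals of good pairs -/

theorem IsRemoval.of_covBy (hc : M' ⋖ M) (hl : IsLabel M' M (ℓ, u)) : IsRemoval M' M ℓ u := by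
  have hcard := card_lt_of_lt hc.1
  obtain ⟨hℓ, hL⟩ := eq_erase_of_sdiff_eq_singleton hl.1
    (by rwa [← M.card_eq, ← M'.card_eq])
  obtain ⟨hu, hU⟩ := eq_erase_of_sdiff_eq_singleton hl.2 hcard
  exact ⟨hℓ, hu, hL, hU⟩

theorem IsRemoval.isLabel (h : IsRemoval M' M ℓ u) : IsLabel M' M (ℓ, u) := by
  constructor
  · rw [h.L_eq, Finset.sdiff_erase_self h.mem_L]
  · rw [h.U_eq, Finset.sdiff_erase_self h.mem_U]

theorem IsRemoval.covBy (h : IsRemoval M' M ℓ u) (hg : M.GoodPair ℓ u) : M' ⋖ M := by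
  have hcard := h.card_U
  refine ⟨⟨h.le hg, ?_⟩, fun K h1 h2 => ?_⟩
  · rintro rfl
    omega
  · have := card_lt_of_lt h1
    have := card_lt_of_lt h2
    omega

/-- The covers with label `(ℓ, u)` are the removals of good pairs. -/
theorem covBy_and_isLabel_iff :
    M' ⋖ M ∧ IsLabel M' M (ℓ, u) ↔ IsRemoval M' M ℓ u ∧ M.GoodPair ℓ u := by
  constructor
  · rintro ⟨hc, hl⟩
    have h := IsRemoval.of_covBy hc hl
    exact ⟨h, h.goodPair hc.1.1⟩
  · rintro ⟨h, hg⟩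
    exact ⟨h.covBy hg, h.isLabel⟩

end LPM

/-! ### Shifting a step to an adjacent position -/

section ShiftSet

variable {n : ℕ} {b c u : Fin n} {B : Finset (Fin n)}

/-- Replace the element `c` by `b`, if possible. -/
def shiftSet (b c : Fin n) (B : Finset (Fin n)) : Finset (Fin n) :=
  if c ∈ B ∧ b ∉ B then insert b (B.erase c) else B

/-- On sets avoiding `b` the shift is induced by a bijection of the ground set, hence it is
injective and commutes with erasing elements. -/
theorem shiftSet_eq_image (hb : b ∉ B) : shiftSet b c B = B.image (Equiv.swap b c) := by
  have hmem : ∀ x, x ∈ B.image (Equiv.swap b c) ↔ Equiv.swap b c x ∈ B := by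
    intro x
    rw [Finset.mem_image]
    constructor
    · rintro ⟨y, hy, rfl⟩
      rwa [Equiv.swap_apply_self]
    · exact fun h => ⟨_, h, Equiv.swap_apply_self _ _ _⟩
  ext x
  rw [hmem, shiftSet]
  rcases eq_or_ne x b with rfl | hxb
  · rw [Equiv.swap_apply_left]
    split_ifs with h
    · simp [h.1]
    · simp only [hb, false_iff]
      exact fun hc => h ⟨hc, hb⟩
  rcases eq_or_ne x c with rfl | hxc
  · rw [Equiv.swap_apply_right]
    split_ifs with h
    · simp [hxb, hb]
    · simp only [hb, iff_false]
      exact fun hc => h ⟨hc, hb⟩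
  · rw [Equiv.swap_apply_of_ne_of_ne hxb hxc]
    split_ifs <;> simp [hxb, hxc]

theorem card_shiftSet (b c : Fin n) (B : Finset (Fin n)) : (shiftSet b c B).card = B.card := by
  by_cases hb : b ∈ B
  · simp [shiftSet, hb]
  · rw [shiftSet_eq_image hb, Finset.card_image_of_injective _ (Equiv.injective _)]

theorem height_le_height_shiftSet (hbc : b < c) (B : Finset (Fin n)) (i : ℕ) :
    height B i ≤ height (shiftSet b c B) i := by
  unfold shiftSet
  split_ifs with h
  · have := LPM.height_exchange h.1 h.2 i
    have : b.val < c.val := hbc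
    split_ifs at * <;> omega
  · exact le_rfl

theorem swap_le_self (hbc : b < c) (hub : u ≠ b) : Equiv.swap b c u ≤ u := by
  rcases eq_or_ne u c with rfl | huc
  · rw [Equiv.swap_apply_right]
    exact hbc.le
  · rw [Equiv.swap_apply_of_ne_of_ne hub huc]

/-- Away from `b`, the swap only lowers `c` into the vacant adjacent place, which disturbs no
comparison. -/
theorem swap_le_swap_iff (hbc : b.val + 1 = c.val) {p q : Fin n} (hp : p ≠ b) (hq : q ≠ b) :
    Equiv.swap b c p ≤ Equiv.swap b c q ↔ p ≤ q := by
  rw [Ne, Fin.ext_iff] at hp hq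
  simp only [Equiv.swap_apply_def, Fin.le_def, Fin.ext_iff, hp, hq, if_false]
  split_ifs <;> omega

/-- For `u = c`, the step at `b` is east, so the path has the same height before `b` and before `c`.
Every other step of `B` lies on the same side of `b` as of `c`. -/
theorem height_shiftSet_swap (hbc : b.val + 1 = c.val) (hb : b ∉ B) (hu : u ∈ B) :
    height (shiftSet b c B) (Equiv.swap b c u).val = height B u.val := by
  have hub : u ≠ b := by rintro rfl; exact hb hu
  rcases eq_or_ne u c with rfl | huc
  · have h1 := LPM.height_exchange hu hb b.val
    have h2 := height_succ B b
    rw [if_neg hb, hbc] at h2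
    rw [Equiv.swap_apply_right, shiftSet, if_pos ⟨hu, hb⟩, h2]
    split_ifs at h1 <;> omega
  · rw [Equiv.swap_apply_of_ne_of_ne hub huc, shiftSet]
    split_ifs with h
    · have h1 := LPM.height_exchange h.1 h.2 u.val
      rw [Ne, Fin.ext_iff] at hub huc
      split_ifs at h1 <;> omega
    · rfl

end ShiftSet

/-! ### The shift on lattice path matroids -/

namespace LPM

variable {n : ℕ} {b c : Fin n} {M M' : LPM n} {ℓ u : Fin n}

/-- Replace `c` by the smaller element `b` in the upper path, if possible. -/
def shift (hbc : b < c) (M : LPM n) : LPM n where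
  U := shiftSet b c M.U
  L := M.L
  card_eq := by rw [card_shiftSet, M.card_eq]
  noncrossing i := (M.noncrossing i).trans (height_le_height_shiftSet hbc M.U i)

theorem shift_injOn (hbc : b < c) : Set.InjOn (shift hbc) {M | b ∉ M.U} := by
  intro M hM K hK h
  have hU : shiftSet b c M.U = shiftSet b c K.U := congrArg LPM.U h
  rw [shiftSet_eq_image hM, shiftSet_eq_image hK] at hU
  exact LPM.ext (Finset.image_injective (Equiv.injective _) hU)
    (show (shift hbc M).L = (shift hbc K).L by rw [h])

/-- The start of `u` keeps its height and moves weakly west, so the start of `ℓ` remains weakly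
south-east of it. -/
theorem GoodPair.shift (hbc : b < c) (hs : b.val + 1 = c.val) (hb : b ∉ M.U)
    (hg : M.GoodPair ℓ u) : (M.shift hbc).GoodPair ℓ (Equiv.swap b c u) := by
  have hh : height (M.shift hbc).U (Equiv.swap b c u).val = height M.U u.val :=
    height_shiftSet_swap hs hb hg.mem_U
  have hub : u ≠ b := by rintro rfl; exact hb hg.mem_U
  refine ⟨hg.mem_L, ?_, ?_, ?_⟩
  · change _ ∈ shiftSet b c M.U
    rw [shiftSet_eq_image hb]
    exact Finset.mem_image_of_mem _ hg.mem_U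
  · rw [hh]
    exact hg.north_le
  · rw [hh]
    have : (Equiv.swap b c u).val ≤ u.val := swap_le_self hbc hub
    exact (Nat.add_le_add_right this _).trans hg.east_le

theorem IsRemoval.shift (hbc : b < c) (hb : b ∉ M.U) (h : IsRemoval M' M ℓ u) :
    IsRemoval (M'.shift hbc) (M.shift hbc) ℓ (Equiv.swap b c u) := by
  have hb' : b ∉ M'.U := by
    rw [h.U_eq]
    exact fun hc => hb (Finset.mem_of_mem_erase hc)
  refine ⟨h.mem_L, ?_, h.L_eq, ?_⟩
  · change _ ∈ shiftSet b c M.U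
    rw [shiftSet_eq_image hb]
    exact Finset.mem_image_of_mem _ h.mem_U
  · change shiftSet b c M'.U = (shiftSet b c M.U).erase _
    rw [shiftSet_eq_image hb, shiftSet_eq_image hb', h.U_eq,
      Finset.image_erase (Equiv.injective _)]

theorem shift_uniformZero (hbc : b < c) : (uniformZero n).shift hbc = uniformZero n :=
  LPM.ext (by simp [shift, uniformZero, shiftSet]) rfl

theorem shift_Mk1 [NeZero n] (hbc : b < c) : (Mk1 b).shift hbc = Mk1 c := by
  refine LPM.ext ?_ rfl
  have hne := hbc.ne
  change shiftSet b c (Finset.univ.erase b) = Finset.univ.erase c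
  rw [shiftSet, if_pos ⟨by simp [hne.symm], by simp⟩]
  ext x
  rcases eq_or_ne x b with rfl | h
  · simp [hne]
  · simp [h]

end LPM

/-! ### The injection between sets of falling chains -/

section FallingChain

variable {n : ℕ} {b c : Fin n}

theorem IsLabelWord.isRemoval {C : List (LPM n)} {w : List (Fin n × Fin n)} (hw : IsLabelWord C w)
    (hC : C.IsChain (· ⋖ ·)) (i : ℕ) (hc : i + 1 < C.length) (hi : i < w.length) :
    LPM.IsRemoval C[i] C[i + 1] w[i].1 w[i].2 ∧ C[i + 1].GoodPair w[i].1 w[i].2 :=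
  LPM.covBy_and_isLabel_iff.1 ⟨List.isChain_iff_getElem.1 hC i hc, hw.2 i hc hi⟩

variable [NeZero n]

/-- Each cover only erases an element of the upper path, so `b`, absent at the top, is absent
everywhere; `k` is the distance from the top. -/
theorem notMem_U_of_isLabelWord {C : List (LPM n)} {w : List (Fin n × Fin n)}
    (hw : IsLabelWord C w) (hC : C.IsChain (· ⋖ ·)) (hl : C.getLast? = some (Mk1 b)) (k : ℕ) :
    ∀ (i : ℕ) (hi : i < C.length), i + k + 1 = C.length → b ∉ C[i].U := by
  induction k with
  | zero =>
    intro i hi hk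
    have : C[i] = Mk1 b := by
      rw [List.getLast?_eq_getElem?, show C.length - 1 = i by omega,
        List.getElem?_eq_getElem hi] at hl
      exact Option.some_injective _ hl
    rw [this]
    simp [Mk1]
  | succ k ih =>
    intro i hi hk hb
    have hlen := hw.1
    have h := (hw.isRemoval hC i (by omega) (by omega)).1
    rw [h.U_eq] at hb
    exact ih (i + 1) (by omega) (by omega) (Finset.mem_of_mem_erase hb)

theorem notMem_U_of_mem_FC {C : List (LPM n)} (hC : C ∈ FC b) {M : LPM n} (hM : M ∈ C) :
    b ∉ M.U := by
  obtain ⟨⟨-, hl, hch⟩, w, hw, -⟩ := hC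
  obtain ⟨i, hi, rfl⟩ := List.getElem_of_mem hM
  exact notMem_U_of_isLabelWord hw hch hl (C.length - 1 - i) i hi (by omega)

theorem map_shift_mem_FC (hbc : b < c) (hs : b.val + 1 = c.val) {C : List (LPM n)}
    (hC : C ∈ FC b) : C.map (LPM.shift hbc) ∈ FC c := by
  have hb : ∀ (i : ℕ) (hi : i < C.length), b ∉ C[i].U :=
    fun i hi => notMem_U_of_mem_FC hC (List.getElem_mem hi)
  obtain ⟨⟨hh, hl, hch⟩, w, hw, hf⟩ := hC
  have hlen := hw.1
  have key : ∀ (i : ℕ) (hc : i + 1 < C.length) (hi : i < w.length),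
      C[i].shift hbc ⋖ C[i + 1].shift hbc ∧
        IsLabel (C[i].shift hbc) (C[i + 1].shift hbc) (w[i].1, Equiv.swap b c w[i].2) := by
    intro i hc hi
    obtain ⟨hr, hg⟩ := hw.isRemoval hch i hc hi
    exact LPM.covBy_and_isLabel_iff.2 ⟨hr.shift hbc (hb _ hc), hg.shift hbc hs (hb _ hc)⟩
  -- A label's second coordinate is a step of an upper path in the chain, so it is never `b`; this
  -- is what makes the swap order-preserving on labels.
  have hne : ∀ (i : ℕ) (hi : i < w.length), w[i].2 ≠ b := by
    intro i hi h
    exact hb (i + 1) (by omega) (h ▸ (hw.isRemoval hch i (by omega) hi).1.mem_U)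
  refine ⟨⟨?_, ?_, ?_⟩, w.map fun p => (p.1, Equiv.swap b c p.2), ⟨?_, ?_⟩, ?_⟩
  · rw [List.head?_map, hh, Option.map_some, LPM.shift_uniformZero]
  · rw [List.getLast?_map, hl, Option.map_some, LPM.shift_Mk1]
  · rw [List.isChain_iff_getElem]
    intro i hi
    rw [List.length_map] at hi
    simpa using (key i hi (by omega)).1
  · simpa using hlen
  · intro i hi hi'
    rw [List.length_map] at hi hi'
    simpa using (key i hi hi').2
  · rw [List.isChain_iff_getElem] at hf ⊢
    intro i hi
    rw [List.length_map] at hi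
    have h := hf i hi
    have h1 := hne i (by omega)
    have h2 := hne (i + 1) hi
    simpa only [List.getElem_map, lt_iff_le_not_ge, Prod.le_def, swap_le_swap_iff hs h1 h2,
      swap_le_swap_iff hs h2 h1] using h

/-- Shifting a chain member by member is injective because every member has an upper path avoiding
`b`, where `LPM.shift` is injective. -/
theorem encard_FC_le_of_succ (hs : b.val + 1 = c.val) : (FC b).encard ≤ (FC c).encard := by
  have hbc : b < c := Fin.lt_def.2 (by omega)
  refine Set.encard_le_encard_of_injOn (f := List.map (LPM.shift hbc))
    (fun C hC => map_shift_mem_FC hbc hs hC) fun C hC D hD h => ?_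
  refine List.ext_getElem (by simpa using congrArg List.length h) fun i h1 h2 => ?_
  refine LPM.shift_injOn hbc (notMem_U_of_mem_FC hC (List.getElem_mem h1))
    (notMem_U_of_mem_FC hD (List.getElem_mem h2)) ?_
  have := List.getElem_of_eq h (i := i) (by simpa using h1)
  simpa using this

theorem encard_FC_mono (d : ℕ) : ∀ {a b : Fin n}, a.val = b.val + d →
    (FC b).encard ≤ (FC a).encard := by
  induction d with
  | zero => intro a b h; rw [show a = b from Fin.ext (by simpa using h)]
  | succ d ih =>
    intro a b h
    have ha := a.isLt
    exact (ih (a := ⟨b.val + d, by omega⟩) rfl).trans (encard_FC_le_of_succ (by simp only; omega))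

end FallingChain

end LPMPoset

theorem theorem3p9 (n : ℕ) [NeZero n] (a b : Fin n) (hab : a ≥ b) :
    (LPMPoset.FC a).encard ≥ (LPMPoset.FC b).encard :=
  LPMPoset.encard_FC_mono (a.val - b.val) (by have : b.val ≤ a.val := hab; omega)
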